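/- Let $(A,\rho,[\cdot,\cdot])$ be a Lie algebroid over a smooth manifold $M$: $A\to M$ is a smooth real vector bundle of finite rank, $\rho:A\to TM$ is a smooth bundle map, and $[\cdot,\cdot]$ is a real Lie bracket on $\Gamma(A)$ with $[X,fY]=f[X,Y]+(\rho(X)f)\,Y$. For a $2$-form $\omega\in\Gamma(\wedge^2A^*)$ put $\langle\omega^\flat(X),Y\rangle=\omega(X,Y)$ and $$d\omega(X,Y,Z)=\rho(X)\,\omega(Y,Z)-\rho(Y)\,\omega(X,Z)+\rho(Z)\,\omega(X,Y)-\omega([X,Y],Z)+\omega([X,Z],Y)-\omega([Y,Z],X).$$ Let $\omega_1,\omega_2,\omega_3\in\Gamma(\wedge^2A^*)$ be non-degenerate $2$-forms, let $\pi_i^\sharp:=(\omega_i^\flat)^{-1}:A^*\to A$, and define the transition morphisms $N_i:=\pi_{i-1}^\sharp\circ\omega_{i+1}^\flat:A\to A$, with indices in $\mathbb Z/3\mathbb Z$. Suppose that $(\omega_1,\omega_2,\omega_3)$ is a hypersymplectic or a para-hypersymplectic structure with torsion, that is, there are $\varepsilon_1,\varepsilon_2,\varepsilon_3\in\{1,-1\}$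 with $\varepsilon_1\varepsilon_2\varepsilon_3=-1$ (all equal to $-1$ in the hypersymplectic case, not all equal to $-1$ in the para-hypersymplectic case) such that $$N_i^2=\varepsilon_i\,\mathrm{id}_A\quad(i=1,2,3),\qquad \varepsilon_2\,N_1d\omega_1=\varepsilon_3\,N_2d\omega_2=\varepsilon_1\,N_3d\omega_3,$$ where $N_id\omega_i(X,Y,Z):=d\omega_i(N_iX,N_iY,N_iZ)$ for $X,Y,Z\in\Gamma(A)$. Then $[N_i,N_j]_{FN}=0$ for all $i,j\in\{1,2,3\}$ (including $i=j$), where for endomorphisms $P,Q$ of $A$ the Frölicher–Nijenhuis bracket is $$[P,Q]_{FN}(X,Y)=[PX,QY]+[QX,PY]-P\big([QX,Y]+[X,QY]\big)-Q\big([PX,Y]+[X,PY]\big)+(PQ+QP)[X,Y],\qquad X,Y\in\Gamma(A).$$ -/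

import Mathlib

open scoped Manifold ContDiff Bundle

noncomputable section

namespace LieAlgd

open Bundle ContinuousLinearMap

section Basic

/- `M` is a smooth real manifold modelled on the finite-dimensional space `E`, and `A → M` is a
smooth real vector bundle with fibres `A x` and finite-dimensional model fibre `F`. -/
variable {E : Type*} [NormedAddCommGroup E] [NormedSpace ℝ E]
  {H : Type*} [TopologicalSpace H] (I : ModelWithCorners ℝ E H)
  {M : Type*} [TopologicalSpace M] [ChartedSpace H M]
  (F : Type*) [NormedAddCommGroup F] [NormedSpace ℝ F]
  (A : M → Type*) [TopologicalSpace (TotalSpace F A)]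
  [∀ x, TopologicalSpace (A x)] [∀ x, AddCommGroup (A x)] [∀ x, Module ℝ (A x)]
  [∀ x, IsTopologicalAddGroup (A x)] [∀ x, ContinuousSMul ℝ (A x)]
  [FiberBundle F A] [VectorBundle ℝ F A]

/-- `Γ(A)`: the smooth sections of `A`. -/
abbrev Sec : Type _ := Cₛ^∞⟮I; F, A⟯

/-- Smooth vector bundle endomorphisms of `A` (over the identity of `M`): smooth sections of
`Hom(A, A)`. -/
abbrev EndSec : Type _ := Cₛ^∞⟮I; F →L[ℝ] F, fun x : M ↦ A x →L[ℝ] A x⟯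

/-- Smooth vector bundle morphisms `A → A^*`. -/
abbrev FlatSec : Type _ :=
  Cₛ^∞⟮I; F →L[ℝ] F →L[ℝ] ℝ, fun x : M ↦ A x →L[ℝ] A x →L[ℝ] ℝ⟯

/-- Smooth vector bundle morphisms `A^* → A`. -/
abbrev SharpSec : Type _ :=
  Cₛ^∞⟮I; (F →L[ℝ] ℝ) →L[ℝ] F, fun x : M ↦ (A x →L[ℝ] ℝ) →L[ℝ] A x⟯

variable {I F A}

/-- The action of a bundle endomorphism on sections: `(N X)(x) = N_x (X_x)`. -/
def EndSec.app (N : EndSec I F A) (X : Sec I F A) : Sec I F A where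
  toFun x := N x (X x)
  contMDiff_toFun := N.contMDiff.clm_bundle_apply X.contMDiff

/-- The product `f X` of a smooth function and a smooth section. -/
def smulSec (f : C^∞⟮I, M; ℝ⟯) (X : Sec I F A) : Sec I F A where
  toFun x := f x • X x
  contMDiff_toFun := f.contMDiff.smul_section X.contMDiff

/-- For a bundle map `ρ : A → TM`, the derivative `ρ(X) f` of a function `f` along the vector field
`ρ(X)`. -/
def anchorDeriv (ρ : ∀ x : M, A x →L[ℝ] TangentSpace I x) (X : Sec I F A) (f : M → ℝ) (x : M) :
    ℝ :=
  mfderiv I 𝓘(ℝ, ℝ) f x (ρ x (X x))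

variable (I F A)

/-- A Lie algebroid structure on `A → M`: a smooth bundle map `ρ : A → TM` (the anchor) and a
Lie bracket on `Γ(A)` which satisfy the Leibniz rule `[X, f Y] = f [X, Y] + (ρ(X) f) Y`. -/
structure LieAlgebroid [IsManifold I ∞ M] [ContMDiffVectorBundle ∞ F A I] where
  /-- the anchor -/
  anchor : Cₛ^∞⟮I; F →L[ℝ] E, fun x : M ↦ A x →L[ℝ] TangentSpace I x⟯
  /-- the bracket on sections -/
  bracket : Sec I F A →ₗ[ℝ] Sec I F A →ₗ[ℝ] Sec I F A
  bracket_self : ∀ X, bracket X X = 0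
  jacobi : ∀ X Y Z,
    bracket X (bracket Y Z) + bracket Y (bracket Z X) + bracket Z (bracket X Y) = 0
  leibniz : ∀ (X Y : Sec I F A) (f : C^∞⟮I, M; ℝ⟯) (x : M),
    bracket X (smulSec f Y) x =
      f x • bracket X Y x + anchorDeriv (anchor : ∀ x, A x →L[ℝ] TangentSpace I x) X f x • Y x

/-- A `2`-form `ω ∈ Γ(∧² A^*)`: a smooth field of alternating bilinear forms, given through
`ω^♭ : A → A^*`, `⟨ω^♭ X, Y⟩ = ω(X, Y)`. -/
structure TwoForm where
  /-- the bundle map `ω^♭` -/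
  flat : FlatSec I F A
  alt : ∀ (x : M) (v : A x), flat x v v = 0

variable {I F A}

/-- A `2`-form is non-degenerate if its kernel at each point is zero. -/
def TwoForm.Nondegenerate (Ω : TwoForm I F A) : Prop :=
  ∀ (x : M) (v : A x), (∀ w : A x, Ω.flat x v w = 0) → v = 0

/-- The function `x ↦ ω(X, Y)(x)` on `M`. -/
def TwoForm.eval (Ω : TwoForm I F A) (X Y : Sec I F A) (x : M) : ℝ := Ω.flat x (X x) (Y x)

end Basic

section Inverse

variable {E : Type*} [NormedAddCommGroup E] [NormedSpace ℝ E]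
  {H : Type*} [TopologicalSpace H] {I : ModelWithCorners ℝ E H}
  {M : Type*} [TopologicalSpace M] [ChartedSpace H M]
  {F : Type*} [NormedAddCommGroup F] [NormedSpace ℝ F] [FiniteDimensional ℝ F]
  {A : M → Type*} [TopologicalSpace (TotalSpace F A)]
  [∀ x, TopologicalSpace (A x)] [∀ x, AddCommGroup (A x)] [∀ x, Module ℝ (A x)]
  [∀ x, IsTopologicalAddGroup (A x)] [∀ x, ContinuousSMul ℝ (A x)]
  [FiberBundle F A] [VectorBundle ℝ F A]

theorem isInvertible_of_injective (φ : F →L[ℝ] F →L[ℝ] ℝ) (h : ∀ v, φ v = 0 → v = 0) :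
    φ.IsInvertible := by
  have hinj : Function.Injective φ.toLinearMap := by
    rw [injective_iff_map_eq_zero]; exact h
  have hd : Module.finrank ℝ F = Module.finrank ℝ (F →L[ℝ] ℝ) := by
    have h1 : Module.finrank ℝ (F →L[ℝ] ℝ) = Module.finrank ℝ (F →ₗ[ℝ] ℝ) :=
      (LinearMap.toContinuousLinearMap (𝕜 := ℝ) (E := F) (F' := ℝ)).finrank_eq.symm
    rw [h1]; exact (Subspace.dual_finrank_eq (K := ℝ) (V := F)).symm
  refine ⟨(LinearEquiv.ofInjectiveOfFinrankEq φ.toLinearMap hinj hd).toContinuousLinearEquiv, ?_⟩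
  ext v w
  rfl

theorem TwoForm.isInvertible (Ω : TwoForm I F A) (h : Ω.Nondegenerate) (x : M) :
    (Ω.flat x).IsInvertible := by
  let e : A x ≃L[ℝ] F := VectorBundle.continuousLinearEquivAt ℝ F A x
  let e' : (A x →L[ℝ] ℝ) ≃L[ℝ] (F →L[ℝ] ℝ) := e.arrowCongr (ContinuousLinearEquiv.refl ℝ ℝ)
  have key : ((e' : (A x →L[ℝ] ℝ) →L[ℝ] (F →L[ℝ] ℝ)).comp
      ((Ω.flat x).comp (e.symm : F →L[ℝ] A x))).IsInvertible := by
    apply isInvertible_of_injective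
    intro v hv
    have h1 : Ω.flat x (e.symm v) = 0 := by
      apply e'.injective
      rw [map_zero]
      exact hv
    have h2 : e.symm v = 0 := h x _ (fun w ↦ by rw [h1]; rfl)
    exact e.symm.map_eq_zero_iff.mp h2
  rwa [isInvertible_equiv_comp, isInvertible_comp_equiv] at key

/-- The pointwise inverse of a smooth invertible bundle morphism is smooth. -/
theorem contMDiff_inverse_section
    {F₂ : Type*} [NormedAddCommGroup F₂] [NormedSpace ℝ F₂]
    {B : M → Type*} [TopologicalSpace (TotalSpace F₂ B)]
    [∀ x, TopologicalSpace (B x)] [∀ x, AddCommGroup (B x)] [∀ x, Module ℝ (B x)]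
    [∀ x, IsTopologicalAddGroup (B x)] [∀ x, ContinuousSMul ℝ (B x)]
    [FiberBundle F₂ B] [VectorBundle ℝ F₂ B]
    (φ : ∀ x : M, A x →L[ℝ] B x)
    (hφ : ContMDiff I (I.prod 𝓘(ℝ, F →L[ℝ] F₂)) ∞
      (fun x ↦ TotalSpace.mk' (F →L[ℝ] F₂) (E := fun x : M ↦ A x →L[ℝ] B x) x (φ x)))
    (hinv : ∀ x, (φ x).IsInvertible) :
    ContMDiff I (I.prod 𝓘(ℝ, F₂ →L[ℝ] F)) ∞
      (fun x ↦ TotalSpace.mk' (F₂ →L[ℝ] F) (E := fun x : M ↦ B x →L[ℝ] A x) x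
        (φ x).inverse) := by
  intro x₀
  have h := hφ x₀
  rw [contMDiffAt_hom_bundle] at h ⊢
  refine ⟨h.1, ?_⟩
  have : CompleteSpace F := FiniteDimensional.complete ℝ F
  have hA := FiberBundle.mem_baseSet_trivializationAt' (F := F) (E := A) x₀
  have hB := FiberBundle.mem_baseSet_trivializationAt' (F := F₂) (E := B) x₀
  have hi : (inCoordinates F A F₂ B x₀ x₀ x₀ x₀ (φ x₀)).IsInvertible := by
    rw [inCoordinates_eq hA hB, isInvertible_equiv_comp, isInvertible_comp_equiv]
    exact hinv x₀
  have h3 := (ContDiffAt.contMDiffAt (n := ∞) hi.contDiffAt_map_inverse).comp x₀ h.2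
  refine h3.congr_of_eventuallyEq ?_
  filter_upwards [(trivializationAt F A x₀).open_baseSet.mem_nhds hA,
    (trivializationAt F₂ B x₀).open_baseSet.mem_nhds hB] with x hx hx'
  change inCoordinates F₂ B F A x₀ x x₀ x (φ x).inverse =
    (inCoordinates F A F₂ B x₀ x x₀ x (φ x)).inverse
  rw [inCoordinates_eq hx hx', inCoordinates_eq hx' hx, inverse_equiv_comp, inverse_comp_equiv]
  rfl

/-- The inverse `π` of a non-degenerate `2`-form `ω`, given through `π^♯ : A^* → A`,
which is the inverse of `ω^♭ : A → A^*`. -/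
def TwoForm.sharp (Ω : TwoForm I F A) (h : Ω.Nondegenerate) : SharpSec I F A where
  toFun x := (Ω.flat x).inverse
  contMDiff_toFun := contMDiff_inverse_section (B := fun x : M ↦ A x →L[ℝ] ℝ)
    (fun x ↦ Ω.flat x) Ω.flat.contMDiff (Ω.isInvertible h)

theorem TwoForm.sharp_flat (Ω : TwoForm I F A) (h : Ω.Nondegenerate) (x : M) (v : A x) :
    Ω.sharp h x (Ω.flat x v) = v :=
  (Ω.isInvertible h x).inverse_apply_self v

theorem TwoForm.flat_sharp (Ω : TwoForm I F A) (h : Ω.Nondegenerate) (x : M)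
    (α : A x →L[ℝ] ℝ) : Ω.flat x (Ω.sharp h x α) = α :=
  (Ω.isInvertible h x).self_apply_inverse α

/-- The composition `P ∘ Q : A → A` of smooth bundle morphisms `Q : A → A^*` and
`P : A^* → A`. -/
def compSec (P : SharpSec I F A) (Q : FlatSec I F A) : EndSec I F A where
  toFun x := (P x).comp (Q x)
  contMDiff_toFun := by
    intro x₀
    have hP := P.contMDiff x₀
    have hQ := Q.contMDiff x₀
    rw [contMDiffAt_hom_bundle] at hP hQ ⊢
    refine ⟨hP.1, (hP.2.clm_comp hQ.2).congr_of_eventuallyEq ?_⟩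
    have hA := FiberBundle.mem_baseSet_trivializationAt' (F := F) (E := A) x₀
    have hB := FiberBundle.mem_baseSet_trivializationAt' (F := F →L[ℝ] ℝ)
      (E := fun x : M ↦ A x →L[ℝ] ℝ) x₀
    filter_upwards [(trivializationAt F A x₀).open_baseSet.mem_nhds hA,
      (trivializationAt (F →L[ℝ] ℝ) (fun x : M ↦ A x →L[ℝ] ℝ) x₀).open_baseSet.mem_nhds hB]
      with x hx hx'
    change inCoordinates F A F A x₀ x x₀ x ((P x).comp (Q x)) =
      (inCoordinates (F →L[ℝ] ℝ) (fun x : M ↦ A x →L[ℝ] ℝ) F A x₀ x x₀ x (P x)).comp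
        (inCoordinates F A (F →L[ℝ] ℝ) (fun x : M ↦ A x →L[ℝ] ℝ) x₀ x x₀ x (Q x))
    rw [inCoordinates_eq hx hx, inCoordinates_eq hx hx', inCoordinates_eq hx' hx]
    ext v
    simp only [coe_comp, Function.comp_apply, ContinuousLinearEquiv.coe_coe,
      ContinuousLinearEquiv.symm_apply_apply]

/-- The transition morphisms `N_i = π_{i-1}^♯ ∘ ω_{i+1}^♭` of a triplet of non-degenerate
`2`-forms; the indices are in `ℤ/3`, with `3` identified with `0`. -/
def transition (Ω : ZMod 3 → TwoForm I F A) (h : ∀ i, (Ω i).Nondegenerate) (i : ZMod 3) :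
    EndSec I F A :=
  compSec ((Ω (i - 1)).sharp (h (i - 1))) (Ω (i + 1)).flat

variable [IsManifold I ∞ M] [ContMDiffVectorBundle ∞ F A I]

/-- The derivative `ρ(X) f` of a function `f` along the anchor of the section `X`. -/
def LieAlgebroid.deriv (L : LieAlgebroid I F A) (X : Sec I F A) (f : M → ℝ) (x : M) : ℝ :=
  anchorDeriv (L.anchor : ∀ x, A x →L[ℝ] TangentSpace I x) X f x

/-- The value `dω(X, Y, Z)(x)` of the Lie algebroid differential of a `2`-form. -/
def LieAlgebroid.d (L : LieAlgebroid I F A) (Ω : TwoForm I F A) (X Y Z : Sec I F A) (x : M) : ℝ :=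
  L.deriv X (Ω.eval Y Z) x - L.deriv Y (Ω.eval X Z) x + L.deriv Z (Ω.eval X Y) x
    - Ω.eval (L.bracket X Y) Z x + Ω.eval (L.bracket X Z) Y x - Ω.eval (L.bracket Y Z) X x

/-- The Frölicher–Nijenhuis bracket `[P, Q]_FN` of two endomorphisms of `A`, evaluated on two
sections, with the sign for which `[P, P]_FN` is twice the Nijenhuis torsion of `P` (the opposite
overall sign is also in use). -/
def LieAlgebroid.fn (L : LieAlgebroid I F A) (P Q : EndSec I F A) (X Y : Sec I F A) : Sec I F A :=
  L.bracket (P.app X) (Q.app Y) + L.bracket (Q.app X) (P.app Y)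
    - P.app (L.bracket (Q.app X) Y + L.bracket X (Q.app Y))
    - Q.app (L.bracket (P.app X) Y + L.bracket X (P.app Y))
    + (P.app (Q.app (L.bracket X Y)) + Q.app (P.app (L.bracket X Y)))

/-- `ε`-hypersymplectic structures with torsion: non-degenerate `2`-forms `ω_1, ω_2, ω_3` with
`N_i² = ε_i id` and `ε_2 N_1 dω_1 = ε_3 N_2 dω_2 = ε_1 N_3 dω_3`, where
`(N_i dω_i)(X, Y, Z) = dω_i(N_i X, N_i Y, N_i Z)`. -/
structure IsEpsHypersymplecticWithTorsion (L : LieAlgebroid I F A) (ε : ZMod 3 → ℝ)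
    (Ω : ZMod 3 → TwoForm I F A) (h : ∀ i, (Ω i).Nondegenerate) : Prop where
  eps : ∀ i, ε i = 1 ∨ ε i = -1
  sq : ∀ (i : ZMod 3) (x : M) (v : A x),
    transition Ω h i x (transition Ω h i x v) = ε i • v
  torsion : ∀ (i j : ZMod 3) (X Y Z : Sec I F A) (x : M),
    ε (i + 1) * L.d (Ω i) ((transition Ω h i).app X)
        ((transition Ω h i).app Y) ((transition Ω h i).app Z) x =
      ε (j + 1) * L.d (Ω j) ((transition Ω h j).app X)
        ((transition Ω h j).app Y) ((transition Ω h j).app Z) x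

/-- Hypersymplectic structures with torsion: `ε_1 = ε_2 = ε_3 = -1`. -/
def IsHypersymplecticWithTorsion (L : LieAlgebroid I F A)
    (Ω : ZMod 3 → TwoForm I F A) (h : ∀ i, (Ω i).Nondegenerate) : Prop :=
  IsEpsHypersymplecticWithTorsion L (fun _ ↦ -1) Ω h

/-- Para-hypersymplectic structures with torsion: `ε_1 ε_2 ε_3 = -1`, and the `ε_i` are not all
equal to `-1`. -/
def IsParaHypersymplecticWithTorsion (L : LieAlgebroid I F A)
    (Ω : ZMod 3 → TwoForm I F A) (h : ∀ i, (Ω i).Nondegenerate) : Prop :=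
  ∃ ε : ZMod 3 → ℝ, ε 1 * ε 2 * ε 3 = -1 ∧ (¬ ∀ i, ε i = -1) ∧
    IsEpsHypersymplecticWithTorsion L ε Ω h

end Inverse

end LieAlgd

end

/-! The condition `N_i² = ε_i` and the definition of the transition morphisms give `N_{i-1} N_{i+1}
= ε_i N_i`; with `ε_1 ε_2 ε_3 = -1`, the opposite product is `-ε_i N_i`, so distinct `N_i`
anticommute. Evaluated on suitable arguments, the torsion condition becomes `dω_{i-1}(N_i X, N_i Y,
Z) = -dω_{i+1}(X, Y, N_i Z)` (`d_transition`).

Put `N = N_i`, `η = ω_{i-1}`, `η' = η(N·,·) = ω_{i+1}`, and let `T` be the Nijenhuis torsion of `N`.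
By `eval_torsion` and the previous identity, `τ(X, Y, Z) = η(T(X, Y), Z)` is totally skew, while `N²
= ε_i` makes `N` change sign when it moves between slots. Three slots then force `τ = 0`
(`torsion_eq_zero`). Finally, `[N_i, N_i]_FN` is twice the torsion, and for `i ≠ j` the bracket is a
combination of the two torsions (`fn_eq_zero_of_anticommute`). -/

noncomputable section

namespace LieAlgd

open Bundle ContinuousLinearMap

/-! ### Anticommuting endomorphisms without torsion -/

section Algebra

variable {V : Type*} [AddCommGroup V] [Module ℝ V]

/-- If two anticommuting endomorphisms, each of square `±1`, have vanishing Nijenhuis torsion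
with respect to a bilinear bracket, then their Frölicher–Nijenhuis bracket vanishes. -/
theorem fn_eq_zero_of_anticommute (B : V →ₗ[ℝ] V →ₗ[ℝ] V) (P Q : V →ₗ[ℝ] V) {a b : ℝ}
    (ha : a = 1 ∨ a = -1) (hb : b = 1 ∨ b = -1)
    (hP : ∀ v, P (P v) = a • v) (hQ : ∀ v, Q (Q v) = b • v) (hPQ : ∀ v, Q (P v) = -P (Q v))
    (tP : ∀ X Y, B (P X) (P Y) - P (B (P X) Y) - P (B X (P Y)) + a • B X Y = 0)
    (tQ : ∀ X Y, B (Q X) (Q Y) - Q (B (Q X) Y) - Q (B X (Q Y)) + b • B X Y = 0) (X Y : V) :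
    B (P X) (Q Y) + B (Q X) (P Y) - P (B (Q X) Y + B X (Q Y)) - Q (B (P X) Y + B X (P Y))
      + (P (Q (B X Y)) + Q (P (B X Y))) = 0 := by
  have h1 := congrArg (fun v ↦ P (Q v)) (tP X Y)
  have h2 := congrArg P (tP X (Q Y))
  have h3 := congrArg P (tP (Q X) Y)
  have h4 := congrArg (fun v ↦ P (Q v)) (tP (Q X) (Q Y))
  have h5 := congrArg (fun v ↦ P (Q v)) (tQ X Y)
  have h6 := congrArg Q (tQ X (P Y))
  have h7 := congrArg Q (tQ (P X) Y)
  have h8 := congrArg (fun v ↦ P (Q v)) (tQ (P X) (P Y))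
  have key : ∀ s : V, (2 : ℝ) • s = 0 → s = 0 := fun s hs ↦
    (smul_eq_zero.mp hs).resolve_left two_ne_zero
  apply key
  simp only [hP, hQ, hPQ, map_add, map_sub, map_neg, map_smul, map_zero, LinearMap.neg_apply,
    neg_neg] at h1 h2 h3 h4 h5 h6 h7 h8 ⊢
  -- Twice the bracket is the sum of `h1`, ..., `h8` with coefficients `-a, -a, -a, -ab, b, -b, -b,
  -- ab`.
  rcases ha with rfl | rfl <;> rcases hb with rfl | rfl
  · linear_combination (norm := module) (-1 : ℝ) • h1 - h2 - h3 - h4 + h5 - h6 - h7 + h8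
  · linear_combination (norm := module) (-1 : ℝ) • h1 - h2 - h3 + h4 - h5 + h6 + h7 - h8
  · linear_combination (norm := module) h1 + h2 + h3 + h4 + h5 - h6 - h7 - h8
  · linear_combination (norm := module) h1 + h2 + h3 - h4 - h5 + h6 + h7 + h8

end Algebra

/-! ### Differentials of 2-forms and Nijenhuis torsion -/

section Sections

variable {E : Type*} [NormedAddCommGroup E] [NormedSpace ℝ E]
  {H : Type*} [TopologicalSpace H] {I : ModelWithCorners ℝ E H}
  {M : Type*} [TopologicalSpace M] [ChartedSpace H M]
  {F : Type*} [NormedAddCommGroup F] [NormedSpace ℝ F]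
  {A : M → Type*} [TopologicalSpace (TotalSpace F A)]
  [∀ x, TopologicalSpace (A x)] [∀ x, AddCommGroup (A x)] [∀ x, Module ℝ (A x)]
  [∀ x, IsTopologicalAddGroup (A x)] [∀ x, ContinuousSMul ℝ (A x)]
  [FiberBundle F A] [VectorBundle ℝ F A]

/-- Every vector of a smooth bundle is the value of a global smooth section. -/
theorem exists_sec_apply_eq [FiniteDimensional ℝ E] [IsManifold I ∞ M] [T2Space M]
    [ContMDiffVectorBundle ∞ F A I] (x : M) (v : A x) : ∃ X : Sec I F A, X x = v := by
  obtain ⟨s, hs, hσ⟩ := FiberBundle.exists_contMDiffOn_extend (k := ∞) I F v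
  obtain ⟨u, hus, hu, hxu⟩ := mem_nhds_iff.mp hs
  obtain ⟨f, hf, -⟩ := (SmoothBumpFunction.nhds_basis_support (I := I) (hu.mem_nhds hxu)).mem_iff.mp
    (hu.mem_nhds hxu)
  -- A bump function, equal to `1` at `x` and supported where the local extension is smooth, cuts it
  -- off to a global section.
  refine ⟨⟨fun y ↦ f y • FiberBundle.extend F v y, ?_⟩, ?_⟩
  · exact ContMDiffOn.smul_section_of_tsupport f.contMDiff.contMDiffOn hu hf (hσ.mono hus)
  · change f x • FiberBundle.extend F v x = v
    simp

/-- The action of a bundle endomorphism on sections as a linear map. -/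
def EndSec.appₗ (N : EndSec I F A) : Sec I F A →ₗ[ℝ] Sec I F A where
  toFun := N.app
  map_add' X Y := ContMDiffSection.ext fun x ↦ (N x).map_add (X x) (Y x)
  map_smul' c X := ContMDiffSection.ext fun x ↦ (N x).map_smul c (X x)

theorem TwoForm.flat_swap (Ω : TwoForm I F A) (x : M) (v w : A x) :
    Ω.flat x v w = -Ω.flat x w v := by
  have h := Ω.alt x (v + w)
  simp only [map_add, add_apply, Ω.alt, zero_add, add_zero] at h
  linarith

theorem TwoForm.eval_swap (Ω : TwoForm I F A) (X Y : Sec I F A) :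
    Ω.eval X Y = -Ω.eval Y X :=
  funext fun x ↦ Ω.flat_swap x (X x) (Y x)

theorem TwoForm.eval_neg_left (Ω : TwoForm I F A) (X Y : Sec I F A) :
    Ω.eval (-X) Y = -Ω.eval X Y := by
  funext x; simp [TwoForm.eval]

theorem TwoForm.eval_neg_right (Ω : TwoForm I F A) (X Y : Sec I F A) :
    Ω.eval X (-Y) = -Ω.eval X Y := by
  funext x; simp [TwoForm.eval]

variable [IsManifold I ∞ M] [ContMDiffVectorBundle ∞ F A I] (L : LieAlgebroid I F A)

theorem LieAlgebroid.bracket_swap (X Y : Sec I F A) : L.bracket X Y = -L.bracket Y X := by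
  have h := L.bracket_self (X + Y)
  simp only [map_add, LinearMap.add_apply, L.bracket_self, zero_add, add_zero] at h
  exact eq_neg_of_add_eq_zero_right h

theorem LieAlgebroid.deriv_neg (X : Sec I F A) (f : M → ℝ) (x : M) :
    L.deriv X (-f) x = -L.deriv X f x := by
  unfold LieAlgebroid.deriv anchorDeriv
  rw [mfderiv_neg]
  rfl

theorem LieAlgebroid.deriv_neg_left (X : Sec I F A) (f : M → ℝ) (x : M) :
    L.deriv (-X) f x = -L.deriv X f x := by
  unfold LieAlgebroid.deriv anchorDeriv
  rw [ContMDiffSection.coe_neg, Pi.neg_apply, map_neg, map_neg]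
  rfl

theorem LieAlgebroid.d_neg (η : TwoForm I F A) (X Y Z : Sec I F A) (x : M) :
    L.d η (-X) Y Z x = -L.d η X Y Z x := by
  simp only [LieAlgebroid.d, η.eval_neg_left, η.eval_neg_right, L.deriv_neg, L.deriv_neg_left,
    map_neg, LinearMap.neg_apply, Pi.neg_apply]
  ring

theorem LieAlgebroid.d_swap_left (η : TwoForm I F A) (X Y Z : Sec I F A) (x : M) :
    L.d η X Y Z x = -L.d η Y X Z x := by
  simp only [LieAlgebroid.d]
  rw [L.bracket_swap X Y, η.eval_swap X Y, η.eval_neg_left, L.deriv_neg, Pi.neg_apply]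
  ring

theorem LieAlgebroid.d_swap_right (η : TwoForm I F A) (X Y Z : Sec I F A) (x : M) :
    L.d η X Y Z x = -L.d η X Z Y x := by
  simp only [LieAlgebroid.d]
  rw [L.bracket_swap Y Z, η.eval_swap Y Z, η.eval_neg_left, L.deriv_neg, Pi.neg_apply]
  ring

/-- Only the signs `ε_i` are ever pulled out, so negation suffices and no differentiability of
`η.eval` has to be checked. -/
theorem LieAlgebroid.d_smul₁ (η : TwoForm I F A) {c : ℝ} (hc : c = 1 ∨ c = -1)
    (X Y Z : Sec I F A) (x : M) : L.d η (c • X) Y Z x = c * L.d η X Y Z x := by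
  rcases hc with rfl | rfl
  · simp
  · simp [L.d_neg]

theorem LieAlgebroid.d_smul₂ (η : TwoForm I F A) {c : ℝ} (hc : c = 1 ∨ c = -1)
    (X Y Z : Sec I F A) (x : M) : L.d η X (c • Y) Z x = c * L.d η X Y Z x := by
  rw [L.d_swap_left, L.d_smul₁ η hc, L.d_swap_left η Y]
  ring

theorem LieAlgebroid.d_smul₃ (η : TwoForm I F A) {c : ℝ} (hc : c = 1 ∨ c = -1)
    (X Y Z : Sec I F A) (x : M) : L.d η X Y (c • Z) x = c * L.d η X Y Z x := by
  rw [L.d_swap_right, L.d_smul₂ η hc, L.d_swap_right η X Z]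
  ring

/-- The Nijenhuis torsion of an endomorphism `N` with `N² = e`. -/
def LieAlgebroid.torsion (N : EndSec I F A) (e : ℝ) (X Y : Sec I F A) : Sec I F A :=
  L.bracket (N.app X) (N.app Y) - N.app (L.bracket (N.app X) Y) - N.app (L.bracket X (N.app Y))
    + e • L.bracket X Y

theorem LieAlgebroid.torsion_swap (N : EndSec I F A) (e : ℝ) (X Y : Sec I F A) :
    L.torsion N e X Y = -L.torsion N e Y X := by
  have hneg (Z) : N.app (-Z) = -N.app Z := N.appₗ.map_neg Z
  simp only [LieAlgebroid.torsion]
  rw [L.bracket_swap X Y, L.bracket_swap (N.app X) Y, L.bracket_swap X (N.app Y),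
    L.bracket_swap (N.app X) (N.app Y), hneg, hneg]
  module

/-- Since `N²` is a scalar, expanding both sides leaves the same four brackets. -/
theorem LieAlgebroid.torsion_app_left {N : EndSec I F A} {e : ℝ}
    (hN : ∀ X, N.app (N.app X) = e • X) (X Y : Sec I F A) :
    L.torsion N e (N.app X) Y = -N.app (L.torsion N e X Y) := by
  have h : N.app (L.torsion N e X Y) = N.appₗ (L.torsion N e X Y) := rfl
  rw [h]
  simp only [LieAlgebroid.torsion, map_add, map_sub, map_smul, hN, LinearMap.smul_apply]
  simp only [EndSec.appₗ, LinearMap.coe_mk, AddHom.coe_mk, hN]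
  have h2 (Z) : N.app (e • Z) = e • N.app Z := N.appₗ.map_smul e Z
  rw [h2]
  module

/-- The torsion of `N`, paired with a form `η` for which `N` is symmetric, in terms of the
differentials of `η` and of `η' = η(N ·, ·)`. -/
theorem LieAlgebroid.eval_torsion {N : EndSec I F A} {e : ℝ} (he : e = 1 ∨ e = -1)
    (hN : ∀ X, N.app (N.app X) = e • X) {η η' : TwoForm I F A}
    (h : ∀ X Y, η.eval (N.app X) Y = η'.eval X Y) (X Y Z : Sec I F A) (x : M) :
    η.eval (L.torsion N e X Y) Z x =
      L.d η' (N.app X) Y Z x + L.d η' X (N.app Y) Z x - L.d η (N.app X) (N.app Y) Z x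
        - e * L.d η X Y Z x := by
  have h' (X Y) : η.eval X (N.app Y) = η'.eval X Y := by
    rw [η.eval_swap, h, η'.eval_swap, neg_neg]
  have hs (X Y) : η.eval (e • X) Y = e • η.eval X Y := by
    funext x; simp [TwoForm.eval]
  have hl (X Y) : η'.eval (N.app X) Y = e • η.eval X Y := by
    rw [← h, hN, hs]
  have hr (X Y) : η'.eval X (N.app Y) = e • η.eval X Y := by
    rw [← h', hN, η.eval_swap, hs, η.eval_swap Y X, smul_neg, neg_neg]
  have hd (X : Sec I F A) (f : M → ℝ) : L.deriv X (e • f) x = e * L.deriv X f x := by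
    rcases he with rfl | rfl
    · simp
    · simp [L.deriv_neg]
  have ht : η.eval (L.torsion N e X Y) Z x = η.eval (L.bracket (N.app X) (N.app Y)) Z x
      - η.eval (N.app (L.bracket (N.app X) Y)) Z x - η.eval (N.app (L.bracket X (N.app Y))) Z x
      + e * η.eval (L.bracket X Y) Z x := by
    simp [LieAlgebroid.torsion, TwoForm.eval]
  rw [ht]
  simp only [LieAlgebroid.d, h, h', hl, hr, hd, Pi.smul_apply, smul_eq_mul]
  ring

/-- The torsion of `N` vanishes if `dη(N ·, N ·, ·) = -dη'(·, ·, N ·)`, where the form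
`η' = η(N ·, ·)` is a `2`-form. -/
theorem LieAlgebroid.torsion_eq_zero [FiniteDimensional ℝ E] [T2Space M]
    {N : EndSec I F A} {e : ℝ} (he : e = 1 ∨ e = -1)
    (hN : ∀ X, N.app (N.app X) = e • X) {η η' : TwoForm I F A} (hη : η.Nondegenerate)
    (h : ∀ X Y, η.eval (N.app X) Y = η'.eval X Y)
    (hd : ∀ X Y Z x, L.d η (N.app X) (N.app Y) Z x = -L.d η' X Y (N.app Z) x)
    (X Y : Sec I F A) : L.torsion N e X Y = 0 := by
  have h' (X Y) : η.eval X (N.app Y) = η'.eval X Y := by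
    rw [η.eval_swap, h, η'.eval_swap, neg_neg]
  -- By `hd`, the third term of `eval_torsion` is `dη'(X, Y, NZ)`, so the first three form a sum
  -- over the slots of `N` that is skew in `Y, Z`.
  have skew (X Y Z x) :
      η.eval (L.torsion N e X Y) Z x = -η.eval (L.torsion N e X Z) Y x := by
    rw [L.eval_torsion he hN h, L.eval_torsion he hN h, hd X Y Z, hd X Z Y,
      L.d_swap_right η' (N.app X) Z, L.d_swap_right η' X (N.app Z), L.d_swap_right η' X (N.app Y),
      L.d_swap_right η X Z Y]
    ring
  have skew' (X Y Z x) :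
      η.eval (L.torsion N e X Y) Z x = -η.eval (L.torsion N e Y X) Z x := by
    rw [L.torsion_swap, η.eval_neg_left, Pi.neg_apply]
  have hl (X Y Z x) : η.eval (L.torsion N e (N.app X) Y) Z x =
      -η.eval (L.torsion N e X Y) (N.app Z) x := by
    rw [L.torsion_app_left hN, η.eval_neg_left, h, h', Pi.neg_apply]
  -- Let `a, b, c` be the values with `N` in the first, second, third slot. Then `a = -c`, `b = -c`
  -- and `a = -b`, hence all vanish.
  have zero (X Y Z x) : η.eval (L.torsion N e X Y) (N.app Z) x = 0 := by
    have h1 := hl X Y Z x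
    have h2 := hl Y X Z x
    have h3 := hl X Z Y x
    linarith [skew' X (N.app Y) Z x, skew' Y X (N.app Z) x, skew (N.app X) Z Y x,
      skew X Z (N.app Y) x]
  have vanish (X Y Z x) : η.eval (L.torsion N e X Y) Z x = 0 := by
    -- `N² = ±1` makes every `Z` a value of `N` up to sign.
    have h1 := zero X Y (N.app Z) x
    rw [hN] at h1
    rcases he with rfl | rfl
    · simpa using h1
    · simpa [η.eval_neg_right] using h1
  refine ContMDiffSection.ext fun x ↦ hη x _ fun w ↦ ?_
  obtain ⟨Z, rfl⟩ := exists_sec_apply_eq (I := I) (F := F) x w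
  exact vanish X Y Z x

end Sections

/-! ### Transition morphisms and their brackets -/

section Transition

variable {E : Type*} [NormedAddCommGroup E] [NormedSpace ℝ E]
  {H : Type*} [TopologicalSpace H] {I : ModelWithCorners ℝ E H}
  {M : Type*} [TopologicalSpace M] [ChartedSpace H M]
  {F : Type*} [NormedAddCommGroup F] [NormedSpace ℝ F] [FiniteDimensional ℝ F]
  {A : M → Type*} [TopologicalSpace (TotalSpace F A)]
  [∀ x, TopologicalSpace (A x)] [∀ x, AddCommGroup (A x)] [∀ x, Module ℝ (A x)]
  [∀ x, IsTopologicalAddGroup (A x)] [∀ x, ContinuousSMul ℝ (A x)]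
  [FiberBundle F A] [VectorBundle ℝ F A]
  {Ω : ZMod 3 → TwoForm I F A} {hnd : ∀ i, (Ω i).Nondegenerate}

theorem flat_transition (i : ZMod 3) (x : M) (v : A x) :
    (Ω (i - 1)).flat x (transition Ω hnd i x v) = (Ω (i + 1)).flat x v :=
  (Ω (i - 1)).flat_sharp (hnd (i - 1)) x _

theorem transition_eq_of_flat_eq {i j k : ZMod 3} (hj : i - 1 = j) (hk : i + 1 = k) {x : M}
    {v w : A x} (h : (Ω k).flat x v = (Ω j).flat x w) : transition Ω hnd i x v = w := by
  subst hj hk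
  have h1 : transition Ω hnd i x v = (Ω (i - 1)).sharp (hnd (i - 1)) x ((Ω (i + 1)).flat x v) := rfl
  rw [h1, h, TwoForm.sharp_flat]

section Squares

variable {ε : ZMod 3 → ℝ} (heps : ∀ i, ε i = 1 ∨ ε i = -1)
  (hsq : ∀ (i : ZMod 3) (x : M) (v : A x),
    transition Ω hnd i x (transition Ω hnd i x v) = ε i • v)
  (hprod : ∀ i, ε (i - 1) * ε i * ε (i + 1) = -1)

include heps hsq

/-- As `N_{i-1} = π_{i+1} ω_i`, it suffices to compare `ω_i(N_{i+1} v)` with `ω_{i+1}(ε_i N_i v)`;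
both equal `ω_{i-1}(v)`, the second by `N_i² = ε_i`. -/
theorem transition_pred_succ (i : ZMod 3) (x : M) (v : A x) :
    transition Ω hnd (i - 1) x (transition Ω hnd (i + 1) x v) = ε i • transition Ω hnd i x v := by
  have hi : ε i * ε i = 1 := by rcases heps i with h | h <;> simp [h]
  have h1 : ∀ i : ZMod 3, i - 1 - 1 = i + 1 ∧ i - 1 + 1 = i ∧ i + 1 - 1 = i ∧ i + 1 + 1 = i - 1 := by
    decide
  obtain ⟨h1, h2, h3, h4⟩ := h1 i
  refine transition_eq_of_flat_eq h1 h2 ?_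
  have h5 := flat_transition (Ω := Ω) (hnd := hnd) (i + 1) x v
  have h6 := flat_transition (Ω := Ω) (hnd := hnd) i x (transition Ω hnd i x v)
  rw [h3, h4] at h5
  rw [hsq] at h6
  rw [h5, map_smul, ← h6, map_smul, smul_smul, hi, one_smul]

include hprod

theorem transition_succ_pred (i : ZMod 3) (x : M) (v : A x) :
    transition Ω hnd (i + 1) x (transition Ω hnd (i - 1) x v) =
      -(ε i • transition Ω hnd i x v) := by
  have hi : ε i * ε i = 1 := by rcases heps i with h | h <;> simp [h]
  have hs : ε (i - 1) * ε (i + 1) = -ε i := by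
    linear_combination ε i * hprod i - ε (i - 1) * ε (i + 1) * hi
  -- This gives `v = N_{i-1} N_{i+1} N_i v`; applying `N_{i+1} N_{i-1}` collapses two squares to
  -- `ε_{i-1} ε_{i+1} = -ε_i`.
  have h1 := transition_pred_succ heps hsq i x (transition Ω hnd i x v)
  rw [hsq, smul_smul, hi, one_smul] at h1
  conv_lhs => rw [← h1, hsq, map_smul, hsq, smul_smul, hs, neg_smul]

theorem transition_anticommute {i j : ZMod 3} (hij : i ≠ j) (x : M) (v : A x) :
    transition Ω hnd j x (transition Ω hnd i x v) =
      -transition Ω hnd i x (transition Ω hnd j x v) := by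
  -- Two distinct indices are the two neighbours of the third one, `k`.
  have h : ∀ i j : ZMod 3, i ≠ j →
      ∃ k, (i = k - 1 ∧ j = k + 1) ∨ (i = k + 1 ∧ j = k - 1) := by decide
  obtain ⟨k, ⟨rfl, rfl⟩ | ⟨rfl, rfl⟩⟩ := h i j hij <;>
    simp only [transition_succ_pred heps hsq hprod, transition_pred_succ heps hsq, neg_neg]

end Squares

variable [IsManifold I ∞ M] [ContMDiffVectorBundle ∞ F A I] {L : LieAlgebroid I F A}
  {ε : ZMod 3 → ℝ}

/-- The three equalities of torsions of a structure with torsion express `dω_{i-1}` through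
`dω_{i+1}` and `N_i`. -/
theorem IsEpsHypersymplecticWithTorsion.d_transition
    (h : IsEpsHypersymplecticWithTorsion L ε Ω hnd)
    (hprod : ∀ i, ε (i - 1) * ε i * ε (i + 1) = -1) (i : ZMod 3) (X Y Z : Sec I F A) (x : M) :
    L.d (Ω (i - 1)) ((transition Ω hnd i).app X) ((transition Ω hnd i).app Y) Z x =
      -L.d (Ω (i + 1)) X Y ((transition Ω hnd i).app Z) x := by
  have heps := h.eps
  have hps (X) : (transition Ω hnd (i - 1)).app ((transition Ω hnd (i + 1)).app X) =
      ε i • (transition Ω hnd i).app X :=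
    ContMDiffSection.ext fun x ↦ transition_pred_succ heps h.sq i x (X x)
  have hsp (X) : (transition Ω hnd (i + 1)).app ((transition Ω hnd (i - 1)).app X) =
      -(ε i • (transition Ω hnd i).app X) :=
    ContMDiffSection.ext fun x ↦ transition_succ_pred heps h.sq hprod i x (X x)
  have hsq (k X) : (transition Ω hnd k).app ((transition Ω hnd k).app X) = ε k • X :=
    ContMDiffSection.ext fun x ↦ h.sq k x (X x)
  have hmul (k) : ε k * ε k = 1 := by rcases heps k with h | h <;> simp [h]
  have idx : ∀ i : ZMod 3, i - 1 + 1 = i ∧ i + 1 + 1 = i - 1 := by decide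
  -- With these arguments one side contains `N_{i-1} N_{i+1} = ε_i N_i` twice and `N_{i-1}²` once,
  -- the other `N_{i+1}²` twice and `N_{i+1} N_{i-1} = -ε_i N_i` once.
  have ht := h.torsion (i - 1) (i + 1) ((transition Ω hnd (i + 1)).app X)
    ((transition Ω hnd (i + 1)).app Y) ((transition Ω hnd (i - 1)).app Z) x
  rw [(idx i).1, (idx i).2, hps, hps, hsp, hsq, hsq, hsq, ← neg_smul] at ht
  have hneg : -ε i = 1 ∨ -ε i = -1 := by rcases heps i with h | h <;> simp [h]
  rw [L.d_smul₁ _ (heps i), L.d_smul₂ _ (heps i), L.d_smul₃ _ (heps _),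
    L.d_smul₁ _ (heps _), L.d_smul₂ _ (heps _), L.d_smul₃ _ hneg] at ht
  generalize L.d (Ω (i - 1)) _ _ Z x = p at ht ⊢
  generalize L.d (Ω (i + 1)) _ _ _ x = q at ht ⊢
  rcases heps i with h1 | h1 <;> rcases heps (i - 1) with h2 | h2 <;>
    rcases heps (i + 1) with h3 | h3 <;> simp only [h1, h2, h3] at ht <;> linarith

theorem IsEpsHypersymplecticWithTorsion.torsion_transition [FiniteDimensional ℝ E] [T2Space M]
    (h : IsEpsHypersymplecticWithTorsion L ε Ω hnd)
    (hprod : ∀ i, ε (i - 1) * ε i * ε (i + 1) = -1) (i : ZMod 3) (X Y : Sec I F A) :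
    L.torsion (transition Ω hnd i) (ε i) X Y = 0 :=
  L.torsion_eq_zero (h.eps i) (fun X ↦ ContMDiffSection.ext fun x ↦ h.sq i x (X x))
    (hnd (i - 1)) (η' := Ω (i + 1))
    (fun X Y ↦ funext fun x ↦ congrArg (fun φ ↦ φ (Y x)) (flat_transition i x (X x)))
    (h.d_transition hprod i) X Y

theorem IsEpsHypersymplecticWithTorsion.fn_transition [FiniteDimensional ℝ E] [T2Space M]
    (h : IsEpsHypersymplecticWithTorsion L ε Ω hnd)
    (hprod : ∀ i, ε (i - 1) * ε i * ε (i + 1) = -1) (i j : ZMod 3) (X Y : Sec I F A) :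
    L.fn (transition Ω hnd i) (transition Ω hnd j) X Y = 0 := by
  have ht := h.torsion_transition hprod
  have hsq (k X) : (transition Ω hnd k).app ((transition Ω hnd k).app X) = ε k • X :=
    ContMDiffSection.ext fun x ↦ h.sq k x (X x)
  rcases eq_or_ne i j with rfl | hij
  · have hadd (X Y) : (transition Ω hnd i).app (X + Y) =
        (transition Ω hnd i).app X + (transition Ω hnd i).app Y :=
      (transition Ω hnd i).appₗ.map_add X Y
    have h1 := ht i X Y
    unfold LieAlgebroid.torsion at h1
    unfold LieAlgebroid.fn
    rw [hsq, hadd]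
    linear_combination (norm := module) (2 : ℝ) • h1
  · exact fn_eq_zero_of_anticommute L.bracket (transition Ω hnd i).appₗ (transition Ω hnd j).appₗ
      (h.eps i) (h.eps j) (hsq i) (hsq j)
      (fun X ↦ ContMDiffSection.ext fun x ↦
        transition_anticommute h.eps h.sq hprod hij x (X x))
      (ht i) (ht j) X Y

end Transition

end LieAlgd

end

theorem mainTheorem7
    {E : Type*} [NormedAddCommGroup E] [NormedSpace ℝ E] [FiniteDimensional ℝ E]
    {H : Type*} [TopologicalSpace H] {I : ModelWithCorners ℝ E H}
    {M : Type*} [TopologicalSpace M] [ChartedSpace H M] [IsManifold I ∞ M] [T2Space M]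
    {F : Type*} [NormedAddCommGroup F] [NormedSpace ℝ F] [FiniteDimensional ℝ F]
    {A : M → Type*} [TopologicalSpace (Bundle.TotalSpace F A)]
    [∀ x, TopologicalSpace (A x)] [∀ x, AddCommGroup (A x)] [∀ x, Module ℝ (A x)]
    [∀ x, IsTopologicalAddGroup (A x)] [∀ x, ContinuousSMul ℝ (A x)]
    [FiberBundle F A] [VectorBundle ℝ F A] [ContMDiffVectorBundle ∞ F A I]
    (L : LieAlgd.LieAlgebroid I F A) (Ω : ZMod 3 → LieAlgd.TwoForm I F A)
    (hnd : ∀ i, (Ω i).Nondegenerate)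
    (hΩ : LieAlgd.IsHypersymplecticWithTorsion L Ω hnd ∨
      LieAlgd.IsParaHypersymplecticWithTorsion L Ω hnd)
    (i j : ZMod 3) (X Y : LieAlgd.Sec I F A) :
    L.fn (LieAlgd.transition Ω hnd i) (LieAlgd.transition Ω hnd j) X Y = 0 := by
  rcases hΩ with h | ⟨ε, hε, -, h⟩
  · exact LieAlgd.IsEpsHypersymplecticWithTorsion.fn_transition h (fun _ ↦ by norm_num) i j X Y
  · have hprod : ∀ i, ε (i - 1) * ε i * ε (i + 1) = -1 := by
      -- With `3 = 0`, each case is a cyclic permutation of the given product.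
      have h0 : (3 : ZMod 3) = 0 := rfl
      rw [h0] at hε
      intro i
      fin_cases i
      · change ε 2 * ε 0 * ε 1 = -1
        linarith
      · change ε 0 * ε 1 * ε 2 = -1
        linarith
      · change ε 1 * ε 2 * ε 0 = -1
        exact hε
    exact h.fn_transition hprod i j X Y
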